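/- Let $H$ be a (real or complex) Hilbert space of orthogonal dimension $2^{\aleph_0}$. For a subspace $M$ of an inner product space $E$ write $M^{\perp_E}=\{x\in E:\langle x,m\rangle=0\ \forall m\in M\}$; call $M$ a splitting subspace of $E$ if $M\oplus M^{\perp_E}=E$; and let the orthogonal dimension $\dim E$ of an inner product space $E$ be the common cardinality of its maximal orthonormal systems, i.e. of the orthonormal sets $A\subseteq E$ such that only $0$ is orthogonal to all of $A$. Then there is a linear subspace $S\subseteq H$ with the following properties. 1. $S$ is a dense hyperplane of $H$ (that is, $S$ is dense and $H/S$ has dimension $1$), and $S=\ker f$ for an unbounded linear functional $f$ on $H$. 2. Let $\mathcal U$ be the family of all closed, separable, infinite-dimensional linear subspaces of $H$. Then $A\nsubseteq S$ and $A^{\perp_H}\nsubseteq S$ for every $A\in\mathcal U$; moreover there are vectors $x_A\in A\setminus S$ and $y_A\in A^{\perp_H}\setminus S$ $(A\in\mathcal U)$ such that the family consisting of all the $x_A$ and all the $y_A$ is linearly independent. 3. Every splitting linear subspace $M$ of the inner product space $S$ with countable orthogonal dimension ($\dim M\le\aleph_0$) is finite-dimensional. -/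

import Mathlib

open scoped Cardinal InnerProductSpace

section Defs

variable (𝕜 : Type*) [RCLike 𝕜]

/-- `A` is a maximal orthonormal system (MONS) in the inner product space `E`: its members are
orthonormal, and no nonzero vector of `E` is orthogonal to all of them. A MONS in a linear subspace
`M` is a MONS in the inner product space `↥M`. -/
def IsMONS {E : Type*} [NormedAddCommGroup E] [InnerProductSpace 𝕜 E] (A : Set E) : Prop :=
  Orthonormal 𝕜 ((↑) : A → E) ∧ ∀ x : E, (∀ a ∈ A, ⟪a, x⟫_𝕜 = 0) → x = 0

/-- The orthogonal dimension of the inner product space `E`: the cardinality of a MONS in `E`. All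
of them have the same cardinality, see `IsMONS.mk_eq_orthDim`, and there is one, see
`exists_isMONS`. The orthogonal dimension of a linear subspace `M` is `orthDim 𝕜 ↥M`. -/
noncomputable def orthDim (E : Type*) [NormedAddCommGroup E] [InnerProductSpace 𝕜 E] : Cardinal :=
  sInf {c : Cardinal | ∃ A : Set E, IsMONS 𝕜 A ∧ #A = c}

variable {𝕜}

/-- The linear subspace `M` of the inner product space `E` is splitting: `M ⊕ Mᗮ = E`, where `Mᗮ`
is the orthogonal complement of `M` in `E`. -/
def IsSplitting {E : Type*} [NormedAddCommGroup E] [InnerProductSpace 𝕜 E]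
    (M : Submodule 𝕜 E) : Prop :=
  IsCompl M Mᗮ

variable (𝕜) in
theorem exists_isMONS (E : Type*) [NormedAddCommGroup E] [InnerProductSpace 𝕜 E] :
    ∃ A : Set E, IsMONS 𝕜 A := by
  obtain ⟨A, -, hA, hmax⟩ := exists_maximal_orthonormal (𝕜 := 𝕜) (E := E) (s := ∅)
    (orthonormal_empty 𝕜 E)
  refine ⟨A, hA, fun x hx => ?_⟩
  have h := (maximal_orthonormal_iff_orthogonalComplement_eq_bot hA).1 hmax
  have hx' : x ∈ (Submodule.span 𝕜 A)ᗮ := by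
    rw [Submodule.mem_orthogonal]
    intro u hu
    induction hu using Submodule.span_induction with
    | mem a ha => exact hx a ha
    | zero => simp
    | add a b _ _ ha hb => rw [inner_add_left, ha, hb, add_zero]
    | smul c a _ ha => rw [inner_smul_left, ha, mul_zero]
  rw [h] at hx'
  simpa using hx'

theorem IsMONS.mk_le {E : Type*} [NormedAddCommGroup E] [InnerProductSpace 𝕜 E] {A B : Set E}
    (hA : IsMONS 𝕜 A) (hB : IsMONS 𝕜 B) : #B ≤ #A := by
  by_cases hfin : A.Finite
  · have : FiniteDimensional 𝕜 (Submodule.span 𝕜 A) := FiniteDimensional.span_of_finite 𝕜 hfin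
    have hbot : (Submodule.span 𝕜 A)ᗮ = ⊥ := by
      rw [eq_bot_iff]
      intro x hx
      have := hA.2 x fun a ha =>
        (Submodule.mem_orthogonal _ _).1 hx a (Submodule.subset_span ha)
      simp [this]
    have htop : Submodule.span 𝕜 A = ⊤ := Submodule.orthogonal_eq_bot_iff.1 hbot
    calc #B ≤ Module.rank 𝕜 E := hB.1.linearIndependent.cardinal_le_rank
      _ = Module.rank 𝕜 (Submodule.span 𝕜 A) := by rw [htop, rank_top]
      _ ≤ #A := rank_span_le A
  · have hinf : Infinite A := Set.infinite_coe_iff.2 hfin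
    have hcount : ∀ a : A, {b : B | ⟪(b : E), (a : E)⟫_𝕜 ≠ 0}.Countable := by
      intro a
      refine (hB.1.inner_products_summable (a : E)).countable_support.mono ?_
      intro b hb
      simpa using hb
    have hcov : (Set.univ : Set B) = ⋃ a : A, {b : B | ⟪(b : E), (a : E)⟫_𝕜 ≠ 0} := by
      refine (Set.eq_univ_of_forall fun b => ?_).symm
      by_contra hb
      have hb0 : (b : E) = 0 := hA.2 _ fun a ha => by
        by_contra hne
        refine hb (Set.mem_iUnion.2 ⟨⟨a, ha⟩, fun h0 => hne ?_⟩)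
        exact inner_eq_zero_symm.1 h0
      exact hB.1.ne_zero b hb0
    calc #B = #(Set.univ : Set B) := Cardinal.mk_univ.symm
      _ = #(⋃ a : A, {b : B | ⟪(b : E), (a : E)⟫_𝕜 ≠ 0}) := by rw [← hcov]
      _ ≤ #A * ⨆ a : A, #{b : B | ⟪(b : E), (a : E)⟫_𝕜 ≠ 0} := Cardinal.mk_iUnion_le _
      _ ≤ #A * ℵ₀ := by
        gcongr
        exact ciSup_le' fun a => (hcount a).le_aleph0
      _ = #A := Cardinal.mul_aleph0_eq (Cardinal.aleph0_le_mk A)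

theorem IsMONS.mk_eq_orthDim {E : Type*} [NormedAddCommGroup E] [InnerProductSpace 𝕜 E]
    {A : Set E} (hA : IsMONS 𝕜 A) : #A = orthDim 𝕜 E := by
  obtain ⟨B, hB, hBc⟩ : orthDim 𝕜 E ∈ {c : Cardinal | ∃ A : Set E, IsMONS 𝕜 A ∧ #A = c} :=
    csInf_mem ⟨#A, A, hA, rfl⟩
  rw [← hBc]
  exact le_antisymm (hB.mk_le hA) (hA.mk_le hB)

end Defs

-- A space `H` of orthogonal dimension `𝔠` has at most `𝔠` elements, hence at most `𝔠` closed
-- separable infinite-dimensional subspaces `A`. Each such `A` and each `Aᗮ` is an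
-- infinite-dimensional Hilbert space, so has algebraic dimension at least `𝔠`. Transfinite
-- recursion therefore picks a linearly independent family with one vector from every `A` and one
-- from every `Aᗮ`. Let `f` be linear with value 1 on all of them, and `S = ker f`.
--
-- Were `f` bounded, its Riesz vector would lie in some `A`, and `f` would vanish on `Aᗮ`. So `f` is
-- unbounded and `S` is dense.
--
-- Let `M` split `S` and have a countably infinite maximal orthonormal system with closed span `B`
-- in `H`. Vectors of `Bᗮ` with `f ≠ 0` serve to push vectors into `S`. They give first `M ≤ B`,
-- then `B ≤ M ≤ S`, contrary to the choice of `f`.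

universe u v

/-! ### Independent representatives -/

open Cardinal in
/-- A family of subspaces, each of rank at least the number of its members, has a linearly
independent system of representatives. -/
theorem exists_linearIndependent_mem_of_mk_le_rank {K : Type*} {ι : Type u} {E : Type v}
    [DivisionRing K] [AddCommGroup E] [Module K E] (V : ι → Submodule K E)
    (hV : ∀ i, lift.{v} #ι ≤ lift.{u} (Module.rank K (V i))) :
    ∃ v : ι → E, LinearIndependent K v ∧ ∀ i, v i ∈ V i := by
  classical
  -- With the least possible order type, every proper initial segment has fewer than `#ι` elements,
  -- so its chosen vectors cannot span `V i`.
  obtain ⟨r, hr, hord⟩ := Cardinal.exists_ord_eq ι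
  have step : ∀ (i : ι) (w : ∀ j, r j i → E),
      ∃ x ∈ V i, x ∉ Submodule.span K (Set.range fun j : {j // r j i} => w j.1 j.2) := by
    intro i w
    by_contra! hcon
    have h1 := Submodule.rank_mono (show V i ≤ _ from hcon)
    have h2 := (lift_le.2 h1).trans (lift_le.2 (rank_span_le (R := K)
      (Set.range fun j : {j // r j i} => w j.1 j.2)))
    have h3 := (hV i).trans (h2.trans mk_range_le_lift)
    have h4 : #{j // r j i} < #ι := card_typein_lt (r := r) i hord
    exact absurd (lift_lt.2 h4) (not_lt.2 h3)
  choose F hF hF' using step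
  let v : ι → E := hr.wf.fix F
  have hv : ∀ i, v i = F i fun j _ => v j := fun i => hr.wf.fix_eq F i
  refine ⟨v, ?_, fun i => hv i ▸ hF i _⟩
  have hnot : ∀ i, v i ∉ Submodule.span K (v '' {j | r j i}) := by
    intro i hi
    refine hF' i (fun j _ => v j) ?_
    rw [← hv i]
    convert hi using 2
    rw [Set.image_eq_range]
    rfl
  let := linearOrderOfSTO r
  rw [linearIndependent_iff_finset_linearIndependent]
  intro s
  change LinearIndepOn K v (s : Set ι)
  induction s using Finset.induction_on_max with
  | empty => simp
  | insert a s ha ih =>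
    rw [Finset.coe_insert, linearIndepOn_insert fun h => lt_irrefl a (ha a h)]
    exact ⟨ih, fun h => hnot a (Submodule.span_mono (Set.image_mono ha) h)⟩

/-! ### Orthonormal systems and algebraic dimension -/

section

variable {𝕜 E : Type*} [RCLike 𝕜] [NormedAddCommGroup E] [InnerProductSpace 𝕜 E]

theorem IsMONS.finiteDimensional {A : Set E} (hA : IsMONS 𝕜 A) (hfin : A.Finite) :
    FiniteDimensional 𝕜 E := by
  have : FiniteDimensional 𝕜 (Submodule.span 𝕜 A) := FiniteDimensional.span_of_finite 𝕜 hfin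
  have hbot : (Submodule.span 𝕜 A)ᗮ = ⊥ := by
    rw [eq_bot_iff]
    intro x hx
    simp [hA.2 x fun a ha => (Submodule.mem_orthogonal _ _).1 hx a (Submodule.subset_span ha)]
  rw [Submodule.orthogonal_eq_bot_iff.1 hbot] at this
  exact Module.finite_def.2 (Module.Finite.iff_fg.1 this)

theorem IsMONS.span_dense [CompleteSpace E] {A : Set E} (hA : IsMONS 𝕜 A) :
    (Submodule.span 𝕜 A).topologicalClosure = ⊤ := by
  rw [Submodule.topologicalClosure_eq_top_iff, eq_bot_iff]
  intro x hx
  simp [hA.2 x fun a ha => (Submodule.mem_orthogonal _ _).1 hx a (Submodule.subset_span ha)]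

variable (𝕜 E) in
theorem exists_orthonormal_nat (h : ¬ FiniteDimensional 𝕜 E) : ∃ e : ℕ → E, Orthonormal 𝕜 e := by
  obtain ⟨A, hA⟩ := exists_isMONS 𝕜 E
  have : Infinite A := Set.infinite_coe_iff.2 fun hfin => h (hA.finiteDimensional hfin)
  let g := Infinite.natEmbedding A
  exact ⟨fun n => (g n : E), hA.1.comp g g.injective⟩

open Cardinal in
/-- An infinite-dimensional Hilbert space has algebraic dimension at least `2 ^ ℵ₀`. -/
theorem continuum_le_rank [CompleteSpace E] (h : ¬ FiniteDimensional 𝕜 E) :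
    𝔠 ≤ Module.rank 𝕜 E := by
  obtain ⟨e, he⟩ := exists_orthonormal_nat 𝕜 E h
  let I := Set.Ioo (0 : ℝ) 1
  -- The coordinates `n ↦ t ^ n` are distinct characters of the monoid `ℕ`, hence independent by
  -- Dedekind's lemma.
  let v : I → E := fun t => ∑' n, ((t : ℝ) ^ n : 𝕜) • e n
  have hsum : ∀ t : I, Summable fun n => ((t : ℝ) ^ n : 𝕜) • e n := by
    intro t
    refine Summable.of_norm_bounded (summable_geometric_of_lt_one t.2.1.le t.2.2) fun n => ?_
    rw [norm_smul, he.1 n, mul_one, norm_pow, RCLike.norm_ofReal, abs_of_pos t.2.1]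
  let Φ : E →ₗ[𝕜] (Multiplicative ℕ → 𝕜) := LinearMap.pi fun n => innerₛₗ 𝕜 (e n.toAdd)
  have hΦ : ⇑Φ ∘ v = (fun g : Multiplicative ℕ →* 𝕜 => (g : Multiplicative ℕ → 𝕜)) ∘
      fun t : I => powersHom 𝕜 ((t : ℝ) : 𝕜) := by
    funext t n
    have h1 : ⟪e n.toAdd, v t⟫_𝕜 = ∑' m, ⟪e n.toAdd, ((t : ℝ) ^ m : 𝕜) • e m⟫_𝕜 :=
      (innerSL 𝕜 (e n.toAdd)).map_tsum (hsum t)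
    have h2 : ⟪e n.toAdd, v t⟫_𝕜 = ((t : ℝ) : 𝕜) ^ n.toAdd := by
      rw [h1, tsum_eq_single n.toAdd]
      · rw [inner_smul_right, inner_self_eq_norm_sq_to_K, he.1]
        simp
      · intro m hm
        rw [inner_smul_right, he.2 hm.symm, mul_zero]
    simpa [Φ] using h2
  have hli : LinearIndependent 𝕜 v := by
    refine LinearIndependent.of_comp Φ ?_
    rw [hΦ]
    refine (linearIndependent_monoidHom (Multiplicative ℕ) 𝕜).comp _ fun s t hst => ?_
    exact Subtype.ext (RCLike.ofReal_injective ((powersHom 𝕜).injective hst))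
  have := hli.cardinal_lift_le_rank
  rwa [mk_Ioo_real zero_lt_one, lift_continuum, lift_uzero] at this

/-- Only countably many members of an orthonormal set fail to be orthogonal to a separable
subspace. -/
theorem Orthonormal.countable_notMem_orthogonal {D : Set E} (hD : Orthonormal 𝕜 ((↑) : D → E))
    {A : Submodule 𝕜 E} (hA : TopologicalSpace.IsSeparable (A : Set E)) :
    {d : D | (d : E) ∉ Aᗮ}.Countable := by
  obtain ⟨C, hCA, hC, hAC⟩ := hA.exists_countable_dense_subset
  have hcov : {d : D | (d : E) ∉ Aᗮ} ⊆ ⋃ c ∈ C, {d : D | ⟪(d : E), c⟫_𝕜 ≠ 0} := by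
    intro d hd
    by_contra hcon
    simp only [Set.mem_iUnion, Set.mem_ofPred_eq, not_exists, not_not] at hcon
    refine hd ((Submodule.mem_orthogonal' _ _).2 fun u hu => ?_)
    have hcl : IsClosed {x : E | ⟪(d : E), x⟫_𝕜 = 0} :=
      isClosed_eq (by fun_prop) continuous_const
    exact closure_minimal (fun c hc => hcon c hc) hcl (hAC hu)
  refine (hC.biUnion fun c _ => ?_).mono hcov
  refine (hD.inner_products_summable c).countable_support.mono fun b hb => ?_
  simpa using hb

/-- All but countably many members of an uncountable maximal orthonormal system lie in `Aᗮ`. -/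
theorem not_finiteDimensional_orthogonal (hE : ℵ₀ < orthDim 𝕜 E) {A : Submodule 𝕜 E}
    (hA : TopologicalSpace.IsSeparable (A : Set E)) : ¬ FiniteDimensional 𝕜 Aᗮ := by
  intro hfin
  obtain ⟨D, hD⟩ := exists_isMONS 𝕜 E
  have hc := hD.1.countable_notMem_orthogonal hA
  let T : Set D := {d | (d : E) ∈ Aᗮ}
  have hli : LinearIndependent 𝕜 fun d : T => (⟨d.1.1, d.2⟩ : Aᗮ) := by
    refine LinearIndependent.of_comp Aᗮ.subtype ?_
    exact hD.1.linearIndependent.comp (fun d : T => d.1) Subtype.val_injective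
  have hT : T.Countable := Set.Finite.countable (Set.finite_coe_iff.1 hli.finite_of_isNoetherian)
  have huniv : (Set.univ : Set D).Countable := (hT.union hc).mono fun d _ => em _
  have : #D ≤ ℵ₀ := by simpa using huniv.le_aleph0
  rw [hD.mk_eq_orthDim] at this
  exact absurd hE (not_lt.2 this)

/-! ### Cardinality of the space and of its separable subspaces -/

variable (𝕜) in
theorem RCLike.mk_eq_continuum : #𝕜 = 𝔠 := by
  refine le_antisymm ?_ (continuum_le_cardinal_of_nontriviallyNormedField 𝕜)
  have hinj : Function.Injective fun z : 𝕜 => (RCLike.re z, RCLike.im z) := fun z w h => by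
    simp only [Prod.mk.injEq] at h
    exact RCLike.ext h.1 h.2
  simpa [Cardinal.mk_real] using Cardinal.lift_mk_le_lift_mk_of_injective hinj

/-- A Hilbert space of orthogonal dimension `2 ^ ℵ₀` has at most `2 ^ ℵ₀` elements. -/
theorem mk_le_continuum_of_orthDim_eq [CompleteSpace E] (h : orthDim 𝕜 E = 𝔠) : #E ≤ 𝔠 := by
  obtain ⟨D, hD⟩ := exists_isMONS 𝕜 E
  have hD' : #D = 𝔠 := hD.mk_eq_orthDim.trans h
  have : Nonempty D := Cardinal.mk_ne_zero_iff.1 (hD' ▸ Cardinal.continuum_ne_zero)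
  have hspan : #(Submodule.span 𝕜 D) ≤ 𝔠 := by
    have h1 : Function.Surjective (Finsupp.linearCombination 𝕜 ((↑) : D → E)).rangeRestrict :=
      LinearMap.surjective_rangeRestrict _
    have : Infinite 𝕜 := Module.Free.infinite ℚ 𝕜
    have h2 := Cardinal.lift_mk_le_lift_mk_of_surjective h1
    rw [Finsupp.range_linearCombination, Subtype.range_coe] at h2
    rw [Cardinal.mk_finsupp_lift_of_infinite', hD', RCLike.mk_eq_continuum 𝕜] at h2
    simpa using h2
  have hlim : ∀ x : E, ∃ s : ℕ → Submodule.span 𝕜 D,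
      Filter.Tendsto (fun n => (s n : E)) Filter.atTop (nhds x) := by
    intro x
    have hx : x ∈ closure (Submodule.span 𝕜 D : Set E) := by
      rw [← Submodule.topologicalClosure_coe, hD.span_dense]
      trivial
    obtain ⟨s, hs, hsx⟩ := mem_closure_iff_seq_limit.1 hx
    exact ⟨fun n => ⟨s n, hs n⟩, hsx⟩
  choose s hs using hlim
  have hinj : Function.Injective s := fun x y hxy =>
    tendsto_nhds_unique (hs x) (hxy ▸ hs y)
  calc #E ≤ #(ℕ → Submodule.span 𝕜 D) := Cardinal.mk_le_of_injective hinj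
    _ = #(Submodule.span 𝕜 D) ^ ℵ₀ := by simp
    _ ≤ 𝔠 ^ ℵ₀ := Cardinal.power_le_power_right hspan
    _ = 𝔠 := Cardinal.continuum_power_aleph0

variable (𝕜 E) in
/-- The closed, separable, infinite-dimensional subspaces. -/
abbrev SepSubspace : Type _ :=
  {A : Submodule 𝕜 E // IsClosed (A : Set E) ∧
    TopologicalSpace.IsSeparable (A : Set E) ∧ ¬ FiniteDimensional 𝕜 A}

-- A closed separable subspace is determined by a dense sequence in it, and `𝔠 ^ ℵ₀ = 𝔠`.
variable (𝕜) in
theorem mk_sepSubspace_le (h : #E ≤ 𝔠) : #(SepSubspace 𝕜 E) ≤ 𝔠 := by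
  have hseq : ∀ A : SepSubspace 𝕜 E, ∃ s : ℕ → E, (A.1 : Set E) = closure (Set.range s) := by
    rintro ⟨A, hcl, hsep, -⟩
    obtain ⟨C, hCA, hC, hAC⟩ := hsep.exists_countable_dense_subset
    have hne : C.Nonempty := by
      rw [← closure_nonempty_iff]
      exact ⟨0, hAC A.zero_mem⟩
    obtain ⟨s, rfl⟩ := hC.exists_eq_range hne
    exact ⟨s, hAC.antisymm (hcl.closure_subset_iff.2 hCA)⟩
  choose s hs using hseq
  have hinj : Function.Injective s := fun A B hAB =>
    Subtype.ext (SetLike.coe_injective (by rw [hs, hs, hAB]))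
  calc #(SepSubspace 𝕜 E) ≤ #(ℕ → E) := Cardinal.mk_le_of_injective hinj
    _ = #E ^ ℵ₀ := by simp
    _ ≤ 𝔠 ^ ℵ₀ := Cardinal.power_le_power_right h
    _ = 𝔠 := Cardinal.continuum_power_aleph0

/-- The closed linear span of a countable set that contains an infinite orthonormal set. -/
def SepSubspace.closedSpan {C : Set E} (hC : C.Countable) {D : Set E} (hDC : D ⊆ C)
    (hD : Orthonormal 𝕜 ((↑) : D → E)) (hDinf : D.Infinite) : SepSubspace 𝕜 E :=
  ⟨(Submodule.span 𝕜 C).topologicalClosure, Submodule.isClosed_topologicalClosure _, by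
    rw [Submodule.topologicalClosure_coe]
    exact hC.isSeparable.span.closure, fun hfin => hDinf <| by
    have hmem : ∀ d : D, (d : E) ∈ (Submodule.span 𝕜 C).topologicalClosure := fun d =>
      Submodule.le_topologicalClosure _ (Submodule.subset_span (hDC d.2))
    have hli : LinearIndependent 𝕜
        fun d : D => (⟨d, hmem d⟩ : (Submodule.span 𝕜 C).topologicalClosure) :=
      LinearIndependent.of_comp (Submodule.subtype _) hD.linearIndependent
    exact Set.finite_coe_iff.1 hli.finite_of_isNoetherian⟩

theorem SepSubspace.subset_closedSpan {C : Set E} (hC : C.Countable) {D : Set E} (hDC : D ⊆ C)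
    (hD : Orthonormal 𝕜 ((↑) : D → E)) (hDinf : D.Infinite) :
    C ⊆ (SepSubspace.closedSpan hC hDC hD hDinf).1 :=
  fun _ hc => Submodule.le_topologicalClosure _ (Submodule.subset_span hc)

/-! ### The kernel and its splitting subspaces -/

/-- If no orthocomplement of a closed, separable, infinite-dimensional subspace lies in the kernel
of `f`, then `f` is unbounded. -/
theorem not_continuous_of_orthogonal_not_le_ker [CompleteSpace E] (hE : ¬ FiniteDimensional 𝕜 E)
    {f : E →ₗ[𝕜] 𝕜} (hf : ∀ A : SepSubspace 𝕜 E, ∃ y ∈ A.1ᗮ, f y ≠ 0) : ¬ Continuous f := by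
  intro hcont
  obtain ⟨e, he⟩ := exists_orthonormal_nat 𝕜 E hE
  let z := (InnerProductSpace.toDual 𝕜 E).symm ⟨f, hcont⟩
  have hz : ∀ y, ⟪z, y⟫_𝕜 = f y := fun y => InnerProductSpace.toDual_symm_apply
  have hinj : Function.Injective e := he.linearIndependent.injective
  -- The Riesz vector `z` is adjoined so that `f` vanishes on `Aᗮ`.
  let A := SepSubspace.closedSpan (𝕜 := 𝕜) ((Set.countable_range e).insert z)
    (Set.subset_insert _ _) he.toSubtypeRange (Set.infinite_range_of_injective hinj)
  obtain ⟨y, hyA, hy⟩ := hf A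
  refine hy ?_
  rw [← hz]
  exact (Submodule.mem_orthogonal _ _).1 hyA z
    (SepSubspace.subset_closedSpan _ _ _ _ (Set.mem_insert _ _))

theorem finiteDimensional_of_isSplitting_ker [CompleteSpace E] {f : E →ₗ[𝕜] 𝕜}
    (hx : ∀ A : SepSubspace 𝕜 E, ∃ x ∈ A.1, f x ≠ 0)
    (hy : ∀ A : SepSubspace 𝕜 E, ∃ y ∈ A.1ᗮ, f y ≠ 0)
    {M : Submodule 𝕜 (LinearMap.ker f)} (hM : IsSplitting M) (hdim : orthDim 𝕜 M ≤ ℵ₀) :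
    FiniteDimensional 𝕜 M := by
  by_contra hinf
  obtain ⟨D, hD⟩ := exists_isMONS 𝕜 M
  have hDinf : D.Infinite := fun h => hinf (hD.finiteDimensional h)
  have hDc : D.Countable := by
    rw [← Set.countable_coe_iff, ← Cardinal.mk_le_aleph0_iff, hD.mk_eq_orthDim]
    exact hdim
  let ι : M →ₗᵢ[𝕜] E := (LinearMap.ker f).subtypeₗᵢ.comp M.subtypeₗᵢ
  let D' : Set E := ι '' D
  have hD'c : D'.Countable := hDc.image _
  have hD'inf : D'.Infinite := hDinf.image ι.injective.injOn
  have hD'o : Orthonormal 𝕜 ((↑) : D' → E) := by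
    have h1 : Orthonormal 𝕜 fun d : D => ι d := hD.1.comp_linearIsometry ι
    have h2 : D' = Set.range fun d : D => ι d := Set.image_eq_range _ _
    rw [h2]
    exact h1.toSubtypeRange
  let B := SepSubspace.closedSpan hD'c subset_rfl hD'o hD'inf
  have hD'B : D' ⊆ B.1 := SepSubspace.subset_closedSpan _ _ _ _
  have hBcomplete : CompleteSpace B.1 := B.2.1.completeSpace_coe
  have hBorth : ∀ y : E, (∀ d ∈ D', ⟪d, y⟫_𝕜 = 0) → y ∈ B.1ᗮ := by
    intro y hy
    refine (Submodule.mem_orthogonal' _ _).2 fun u hu => ?_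
    have hle : (Submodule.span 𝕜 D').topologicalClosure ≤ LinearMap.ker (innerₛₗ 𝕜 y) := by
      refine Submodule.topologicalClosure_minimal _ (Submodule.span_le.2 fun d hd => ?_) ?_
      · simpa using inner_eq_zero_symm.1 (hy d hd)
      · exact isClosed_eq (by fun_prop : Continuous fun x => ⟪y, x⟫_𝕜) continuous_const
    exact hle hu
  -- the orthocomplement of `M` consists of the vectors of the kernel orthogonal to `B`
  have hN1 : ∀ n ∈ Mᗮ, (n : E) ∈ B.1ᗮ := by
    intro n hn
    refine hBorth _ ?_
    rintro _ ⟨d, -, rfl⟩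
    exact (Submodule.mem_orthogonal _ _).1 hn d d.2
  have hsplit : ∀ s : LinearMap.ker f, ∃ m ∈ M, ∃ n ∈ Mᗮ, m + n = s := fun s =>
    Submodule.mem_sup.1 (hM.sup_eq_top ▸ Submodule.mem_top)
  have hN2 : ∀ s : LinearMap.ker f, (s : E) ∈ B.1ᗮ → s ∈ Mᗮ := by
    intro s hs
    obtain ⟨m, hm, n, hn, rfl⟩ := hsplit s
    have hm0 : (⟨m, hm⟩ : M) = 0 := by
      refine hD.2 _ fun d hd => ?_
      have hdB : ι d ∈ B.1 := hD'B ⟨d, hd, rfl⟩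
      have h1 : ⟪ι d, (m : E)⟫_𝕜 + ⟪ι d, (n : E)⟫_𝕜 = 0 := by
        rw [← inner_add_right]
        exact (Submodule.mem_orthogonal _ _).1 hs _ hdB
      rwa [(Submodule.mem_orthogonal _ _).1 (hN1 n hn) _ hdB, add_zero] at h1
    have hm0' : m = 0 := congrArg Subtype.val hm0
    rwa [hm0', zero_add]
  have hMB : ∀ m ∈ M, (m : E) ∈ B.1 := by
    intro m hm
    obtain ⟨b, hb, c, hc, hbc⟩ := B.1.exists_add_mem_mem_orthogonal (m : E)
    -- Adjoining `c` makes `y` orthogonal to `c` too, so correcting `c` by a multiple of `y` leaves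
    -- its inner product with `c` unchanged.
    let B' := SepSubspace.closedSpan (hD'c.insert c) (Set.subset_insert _ _) hD'o hD'inf
    have hB' : insert c D' ⊆ B'.1 := SepSubspace.subset_closedSpan _ _ _ _
    obtain ⟨y, hyB', hfy⟩ := hy B'
    have hcy : ⟪c, y⟫_𝕜 = 0 :=
      (Submodule.mem_orthogonal _ _).1 hyB' c (hB' (Set.mem_insert _ _))
    have hyB : y ∈ B.1ᗮ := hBorth y fun d hd =>
      (Submodule.mem_orthogonal _ _).1 hyB' d (hB' (Set.mem_insert_of_mem _ hd))
    let s : LinearMap.ker f := ⟨c - (f c / f y) • y, by simp [hfy]⟩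
    have hsB : (s : E) ∈ B.1ᗮ := Submodule.sub_mem _ hc (Submodule.smul_mem _ _ hyB)
    have h1 : ⟪(m : E), (s : E)⟫_𝕜 = 0 :=
      (Submodule.mem_orthogonal _ _).1 (hN2 s hsB) m hm
    rw [hbc, inner_add_left, (Submodule.mem_orthogonal _ _).1 hsB b hb, zero_add] at h1
    have h2 : ⟪c, c⟫_𝕜 = 0 := by
      simpa [s, inner_sub_right, inner_smul_right, hcy] using h1
    rw [hbc, inner_self_eq_zero.1 h2, add_zero]
    exact hb
  obtain ⟨x, hxB, hfx⟩ := hx B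
  obtain ⟨y, hyB, hfy⟩ := hy B
  -- Here `x - m` lies in both `B` and `Bᗮ`, so `x = m` is in the kernel.
  obtain ⟨m, hm, n, hn, hmn⟩ := hsplit ⟨x - (f x / f y) • y, by simp [hfy]⟩
  have hmn' : (m : E) + n = x - (f x / f y) • y := congrArg Subtype.val hmn
  have hxm : x - m ∈ B.1ᗮ := by
    have : x - m = n + (f x / f y) • y := by
      rw [sub_eq_iff_eq_add', ← add_assoc, hmn', sub_add_cancel]
    rw [this]
    exact Submodule.add_mem _ (hN1 n hn) (Submodule.smul_mem _ _ hyB)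
  have h0 : x - m = 0 := by
    have := (Submodule.mem_orthogonal _ _).1 hxm _ (Submodule.sub_mem _ hxB (hMB m hm))
    exact inner_self_eq_zero.1 this
  rw [sub_eq_zero.1 h0] at hfx
  exact hfx m.2

end

/-! ### Construction of the functional -/

theorem LinearIndependent.exists_linearMap_eq_one {K ι E : Type*} [DivisionRing K]
    [AddCommGroup E] [Module K E] {v : ι → E} (hv : LinearIndependent K v) :
    ∃ f : E →ₗ[K] K, ∀ i, f (v i) = 1 := by
  refine ⟨(Module.Basis.extend hv.linearIndepOn_id).constr ℕ fun _ => 1, fun i => ?_⟩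
  have hi := hv.linearIndepOn_id.subset_extend (Set.subset_univ _) (Set.mem_range_self i)
  have := (Module.Basis.extend hv.linearIndepOn_id).constr_basis ℕ (fun _ => (1 : K)) ⟨v i, hi⟩
  rwa [Module.Basis.extend_apply_self] at this

theorem mainTheorem9 {𝕜 : Type*} [RCLike 𝕜] {H : Type*} [NormedAddCommGroup H]
    [InnerProductSpace 𝕜 H] [CompleteSpace H] (hH : orthDim 𝕜 H = 2 ^ ℵ₀) :
    ∃ S : Submodule 𝕜 H,
      -- `S` is a dense hyperplane, the kernel of an unbounded linear functional
      Dense (S : Set H) ∧ Module.rank 𝕜 (H ⧸ S) = 1 ∧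
      (∃ f : H →ₗ[𝕜] 𝕜, (¬ ∃ C : ℝ, ∀ v : H, ‖f v‖ ≤ C * ‖v‖) ∧ S = LinearMap.ker f) ∧
      -- every closed separable infinite-dimensional `A` and its orthocomplement contain vectors
      -- outside `S`, and these can be chosen linearly independent
      (∃ x y : {A : Submodule 𝕜 H // IsClosed (A : Set H) ∧
            TopologicalSpace.IsSeparable (A : Set H) ∧ ¬ FiniteDimensional 𝕜 A} → H,
        LinearIndependent 𝕜 (Sum.elim x y) ∧
        ∀ A, (x A ∈ A.1 ∧ x A ∉ S) ∧ (y A ∈ A.1ᗮ ∧ y A ∉ S)) ∧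
      -- splitting subspaces of countable orthogonal dimension are finite-dimensional
      ∀ M : Submodule 𝕜 S, IsSplitting M → orthDim 𝕜 M ≤ ℵ₀ → FiniteDimensional 𝕜 M := by
  have hE : ℵ₀ < orthDim 𝕜 H := hH ▸ Cardinal.cantor ℵ₀
  have hmk : #H ≤ 𝔠 := mk_le_continuum_of_orthDim_eq (𝕜 := 𝕜) hH
  have hU : #(SepSubspace 𝕜 H) ≤ 𝔠 := mk_sepSubspace_le 𝕜 hmk
  let V : SepSubspace 𝕜 H ⊕ SepSubspace 𝕜 H → Submodule 𝕜 H :=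
    Sum.elim (fun A => A.1) fun A => A.1ᗮ
  have hV : ∀ i, 𝔠 ≤ Module.rank 𝕜 (V i) := by
    rintro (A | A)
    · have : CompleteSpace A.1 := A.2.1.completeSpace_coe
      exact continuum_le_rank (E := A.1) A.2.2.2
    · exact continuum_le_rank (E := (A.1ᗮ : Submodule 𝕜 H)) (not_finiteDimensional_orthogonal hE A.2.2.1)
  obtain ⟨v, hv, hvV⟩ := exists_linearIndependent_mem_of_mk_le_rank V fun i => by
    refine Cardinal.lift_le.2 (le_trans ?_ (hV i))
    rw [Cardinal.mk_sum, Cardinal.lift_id]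
    exact (add_le_add hU hU).trans_eq Cardinal.continuum_add_self
  obtain ⟨f, hf⟩ := hv.exists_linearMap_eq_one
  have hf0 : ∀ i, f (v i) ≠ 0 := fun i => by simp [hf i]
  have hx : ∀ A : SepSubspace 𝕜 H, ∃ x ∈ A.1, f x ≠ 0 := fun A =>
    ⟨v (.inl A), hvV (.inl A), hf0 _⟩
  have hy : ∀ A : SepSubspace 𝕜 H, ∃ y ∈ A.1ᗮ, f y ≠ 0 := fun A =>
    ⟨v (.inr A), hvV (.inr A), hf0 _⟩
  have hinf : ¬ FiniteDimensional 𝕜 H := fun _ =>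
    not_finiteDimensional_orthogonal hE (A := (⊥ : Submodule 𝕜 H))
      (by simpa using (Set.finite_singleton (0 : H)).isSeparable) inferInstance
  have hcont : ¬ Continuous f := not_continuous_of_orthogonal_not_le_ker hinf hy
  have hf1 : f ≠ 0 := fun h => hcont (h ▸ continuous_zero)
  refine ⟨LinearMap.ker f, ?_, ?_, ⟨f, ?_, rfl⟩, ⟨fun A => v (.inl A), fun A => v (.inr A), ?_,
    fun A => ⟨⟨hvV (.inl A), hf0 _⟩, hvV (.inr A), hf0 _⟩⟩, fun M hM hdim =>
    finiteDimensional_of_isSplitting_ker hx hy hM hdim⟩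
  -- The kernel of a linear functional is closed or dense, and a closed kernel forces continuity.
  · exact f.isClosed_or_dense_ker.resolve_left fun h => hcont (f.continuous_of_isClosed_ker h)
  · have := (f.quotKerEquivOfSurjective (f.surjective hf1)).lift_rank_eq
    simpa using this
  · rintro ⟨C, hC⟩
    exact hcont (f.mkContinuous C hC).continuous
  · convert hv using 1
    funext i
    cases i <;> rfl
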